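/- Identify the first Heisenberg group $\mathbb H$ with $\mathbb R^2\times\mathbb R$ equipped with the group law $(v,z)\cdot(v',z')=\bigl(v+v',\,z+z'+\tfrac12(v_1v_2'-v_2v_1')\bigr)$ and the dilations $\delta_t(v,z)=(tv,t^2z)$, $t>0$. A distance $d$ on $\mathbb H$ is called homogeneous if $d(p\cdot q,p\cdot q')=d(q,q')$ and $d(\delta_t(p),\delta_t(q))=t\,d(p,q)$ for all $p,q,q'\in\mathbb H$ and all $t>0$. Let $d$ be a homogeneous distance on $\mathbb H$, let $B=\{p\in\mathbb H: d(0,p)\le 1\}$, and let $K=\{v\in\mathbb R^2 : (v,z)\in B \text{ for some } z\in\mathbb R\}$. Let $\phi:K\to[0,+\infty)$ be the profile of $d$, that is, the function such that $$B=\{(v,z)\in\mathbb H:\ v\in K,\ -\phi(-v)\le z\le\phi(v)\}.$$ A Besicovitch family of balls in $(\mathbb H,d)$ is a family of closed balls (with positive radii) having a common point and such that the center of each ball of the family belongs to no other ball of the family. Assume that $(\mathbb H,d)$ satisfies the Besicovitch covering property (BCP), that is, there is a constant $C\ge 1$ such that every Besicovitch family of balls in $(\mathbb H,d)$ has at most $C$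 elements. Assume also that $\phi\in C^2(\operatorname{int}(K))$. **Theorem.** Under these assumptions, $\langle\nabla\phi(w),w\rangle<0$ for all $w\in\operatorname{int}(K)\setminus\{0\}$; $\phi(w)<\phi(0)$ for all $w\in K\setminus\{0\}$; and the Hessian $H\phi(0)$ of $\phi$ at $0$ is negative semidefinite, i.e. $\langle H\phi(0)v,v\rangle\le 0$ for all $v\in\mathbb R^2$. Moreover, if $H\phi$ is differentiable at $0$, then $H\phi(0)$ is negative definite, i.e. $\langle H\phi(0)v,v\rangle<0$ for all $v\in\mathbb R^2\setminus\{0\}$. -/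

import Mathlib

/-- The Euclidean plane `ℝ²` (with its Euclidean norm and scalar product). -/
abbrev Plane : Type := EuclideanSpace ℝ (Fin 2)

/-- The standard area form `ω(v, v') = v₁ v'₂ - v₂ v'₁` on `ℝ²`. -/
def omega (v v' : Plane) : ℝ := v 0 * v' 1 - v 1 * v' 0

/-- The first Heisenberg group, identified with `ℝ² × ℝ`.  A separate structure is used so that it
carries neither the additive group structure nor any metric of the product. -/
@[ext]
structure Heisenberg : Type where
  /-- the horizontal component, `π (v, z) = v` -/
  v : Plane
  /-- the vertical component -/
  z : ℝ

namespace Heisenberg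

/-- `(v, z) · (v', z') = (v + v', z + z' + ω(v, v') / 2)`. -/
noncomputable instance : Mul Heisenberg :=
  ⟨fun p q => ⟨p.v + q.v, p.z + q.z + omega p.v q.v / 2⟩⟩

/-- The identity element is the origin. -/
noncomputable instance : One Heisenberg := ⟨⟨0, 0⟩⟩

/-- `(v, z)⁻¹ = (-v, -z)`. -/
noncomputable instance : Inv Heisenberg := ⟨fun p => ⟨-p.v, -p.z⟩⟩

theorem mul_v (p q : Heisenberg) : (p * q).v = p.v + q.v := rfl

theorem mul_z (p q : Heisenberg) : (p * q).z = p.z + q.z + omega p.v q.v / 2 := rfl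

theorem one_v : (1 : Heisenberg).v = 0 := rfl

theorem one_z : (1 : Heisenberg).z = 0 := rfl

theorem inv_v (p : Heisenberg) : (p⁻¹).v = -p.v := rfl

theorem inv_z (p : Heisenberg) : (p⁻¹).z = -p.z := rfl

noncomputable instance : Group Heisenberg :=
  Group.ofLeftAxioms
    (fun a b c => by
      ext1
      · simp only [mul_v]; abel
      · simp only [mul_v, mul_z, omega, PiLp.add_apply]; ring)
    (fun a => by
      ext1
      · simp only [mul_v, one_v, zero_add]
      · simp only [mul_z, one_v, one_z, omega, PiLp.zero_apply]; ring)
    (fun a => by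
      ext1
      · simp only [mul_v, inv_v, one_v, neg_add_cancel]
      · simp only [mul_z, inv_v, inv_z, one_z, omega, PiLp.neg_apply]; ring)

/-- The dilations `δ_t (v, z) = (t v, t² z)`. -/
noncomputable def dilation (t : ℝ) (p : Heisenberg) : Heisenberg := ⟨t • p.v, t ^ 2 * p.z⟩

/-- A distance on the Heisenberg group is homogeneous if it is left-invariant and one-homogeneous
with respect to the dilations `δ_t`, `t > 0`. -/
structure IsHomogeneousDistance (d : MetricSpace Heisenberg) : Prop where
  left_invariant : ∀ p q q' : Heisenberg, dist (p * q) (p * q') = dist q q'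
  homogeneous : ∀ t : ℝ, 0 < t → ∀ p q : Heisenberg,
    dist (dilation t p) (dilation t q) = t * dist p q

/-- The closed unit ball `B` centered at the origin. -/
def unitBall (d : MetricSpace Heisenberg) : Set Heisenberg :=
  {p | dist (1 : Heisenberg) p ≤ 1}

/-- The projection `K = π(B)` of the unit ball on `ℝ²`. -/
def shadow (d : MetricSpace Heisenberg) : Set Plane :=
  (fun p : Heisenberg => p.v) '' unitBall d

/-- `φ` is the profile of the distance `d`: it is nonnegative on `K` and
`B = {(v, z) : v ∈ K, -φ(-v) ≤ z ≤ φ(v)}`.  A profile is a function on `K`; it is represented here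
by a function on `ℝ²` whose values outside `K` are irrelevant.  These conditions determine `φ`
on `K`. -/
structure IsProfile (d : MetricSpace Heisenberg) (φ : Plane → ℝ) : Prop where
  nonneg : ∀ v ∈ shadow d, 0 ≤ φ v
  unitBall_eq : unitBall d = {p | p.v ∈ shadow d ∧ -φ (-p.v) ≤ p.z ∧ p.z ≤ φ p.v}

end Heisenberg

/-- A family of closed balls in a metric space, each ball being given by its center and its positive
radius, is a Besicovitch family if the center of a ball of the family belongs to no other ball of
the family, and if all the balls of the family have a common point.
(Two distinct members of such a family are thus distinct as sets.) -/
structure IsBesicovitchFamily {X : Type*} (d : MetricSpace X) (F : Set (X × ℝ)) : Prop where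
  radius_pos : ∀ b ∈ F, 0 < b.2
  center_notMem : ∀ b ∈ F, ∀ b' ∈ F, b ≠ b' → b.1 ∉ Metric.closedBall b'.1 b'.2
  inter_nonempty : (⋂ b ∈ F, Metric.closedBall b.1 b.2).Nonempty

/-- The Besicovitch covering property: the cardinalities of the Besicovitch families of balls
are bounded by a finite constant. -/
def BesicovitchCoveringProperty {X : Type*} (d : MetricSpace X) : Prop :=
  ∃ C : ℕ, 1 ≤ C ∧ ∀ F : Set (X × ℝ), IsBesicovitchFamily d F → F.encard ≤ C

/-- The Hessian `Hφ` of `φ`, as a linear endomorphism of `ℝ²` at each point: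
the derivative of the gradient `∇φ`. -/
noncomputable def hessian (φ : Plane → ℝ) (w : Plane) : Plane →L[ℝ] Plane :=
  fderiv ℝ (gradient φ) w

open Filter Topology

/-! BCP forbids long sequences in `B` in which each point lies at distance more than one from all
small dilates of its successors: rescaling the `i`-th point by `ε ^ i` turns such a sequence into a
Besicovitch family of balls through the origin.

Take the points `±(w, φ w)`. Expanding to first order in the dilation factor, the separation holds
as soon as `G(w, u) = ⟨∇φ(w), u⟩ ± ω(w, u)/2 > 0`, where `w` precedes `u` and the sign is fixed
along the sequence. If `⟨∇φ(w), w⟩ ≥ 0`, then `G(w, w) ≥ 0` because `ω(w, w) = 0`. For one of the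
two signs `G(w, ·)` is then positive at points arbitrarily close to `w`, and continuity in the first
variable yields chains of any length, contradicting BCP. Hence `φ` decreases along rays, and 0 is a
critical point.

Near 0, `G(ta, tb) / t²` tends to `⟨Hφ(0)a, b⟩ ± ω(a, b)/2`, so the same chain argument makes the
Hessian negative definite. -/

theorem exists_seq_pos_of_frequently {X : Type*} [TopologicalSpace X] {G : X → X → ℝ} {w : X}
    (hG : ∀ b, ContinuousAt (fun a => G a b) w) (hfr : ∃ᶠ b in 𝓝 w, 0 < G w b)
    {U : Set X} (hU : U ∈ 𝓝 w) (n : ℕ) :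
    ∃ q : Fin n → X, (∀ i, q i ∈ U) ∧ (∀ i, 0 < G w (q i)) ∧
      ∀ i j, i < j → 0 < G (q i) (q j) := by
  induction n with
  | zero => exact ⟨Fin.elim0, fun i => i.elim0, fun i => i.elim0, fun i => i.elim0⟩
  | succ n ih =>
    obtain ⟨q, hqU, hqw, hq⟩ := ih
    have hev : ∀ᶠ a in 𝓝 w, ∀ j, 0 < G a (q j) :=
      eventually_all.2 fun j => (hG (q j)).eventually (lt_mem_nhds (hqw j))
    -- The chain grows at its front: a new first point close enough to `w` inherits positivity
    -- against all later points from `w`.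
    obtain ⟨a, ha, haU, haq⟩ := (hfr.and_eventually ((Filter.eventually_mem_set.2 hU).and hev)).exists
    refine ⟨Fin.cons a q, ?_, ?_, ?_⟩
    · intro i; refine Fin.cases ?_ (fun k => ?_) i <;> simp [haU, hqU]
    · intro i; refine Fin.cases ?_ (fun k => ?_) i <;> simp [ha, hqw]
    · intro i j
      refine Fin.cases ?_ (fun k => ?_) j
      · intro h; exact absurd h (Fin.not_lt_zero i)
      · refine Fin.cases ?_ (fun l => ?_) i
        · intro _; simpa using haq k
        · intro h; simpa using hq l k (Fin.succ_lt_succ_iff.1 h)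

theorem eventually_neg_of_hasDerivAt_neg {h : ℝ → ℝ} {h' : ℝ} (hd : HasDerivAt h h' 0)
    (h0 : h 0 = 0) (hneg : h' < 0) : ∀ᶠ t in 𝓝[>] (0 : ℝ), h t < 0 := by
  have h1 := (hasDerivAt_iff_tendsto_slope.1 hd).eventually (gt_mem_nhds hneg)
  have h2 : 𝓝[>] (0 : ℝ) ≤ 𝓝[≠] 0 := nhdsWithin_mono _ fun t (ht : 0 < t) => ht.ne'
  filter_upwards [h2 h1, self_mem_nhdsWithin] with t ht htpos
  have htpos : 0 < t := htpos
  rw [slope_def_field, h0, sub_zero, sub_zero] at ht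
  by_contra hcon
  exact absurd ht (not_lt.2 (div_nonneg (not_lt.1 hcon) htpos.le))

/-! ### The area form -/

theorem omega_self (v : Plane) : omega v v = 0 := by simp [omega, mul_comm]

theorem omega_add_right (v a b : Plane) : omega v (a + b) = omega v a + omega v b := by
  simp only [omega, PiLp.add_apply]; ring

theorem omega_smul_right (t : ℝ) (v a : Plane) : omega v (t • a) = t * omega v a := by
  simp only [omega, PiLp.smul_apply, smul_eq_mul]; ring

theorem omega_smul_left (t : ℝ) (v a : Plane) : omega (t • v) a = t * omega v a := by
  simp only [omega, PiLp.smul_apply, smul_eq_mul]; ring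

theorem omega_swap (v a : Plane) : omega v a = - omega a v := by
  simp only [omega]; ring

theorem continuous_omega_left (b : Plane) : Continuous fun a => omega a b := by
  unfold omega; fun_prop

theorem exists_omega_pos {w : Plane} (hw : w ≠ 0) : ∃ u, 0 < omega w u := by
  refine ⟨!₂[-w 1, w 0], ?_⟩
  have h : omega w !₂[-w 1, w 0] = w 0 ^ 2 + w 1 ^ 2 := by
    simp [omega]; ring
  rw [h]
  by_contra hcon
  apply hw
  have h0 : w 0 = 0 := by nlinarith [sq_nonneg (w 0), sq_nonneg (w 1)]
  have h1 : w 1 = 0 := by nlinarith [sq_nonneg (w 0), sq_nonneg (w 1)]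
  ext i
  fin_cases i
  · simpa using h0
  · simpa using h1

/-- If a linear form is nonnegative at `w ≠ 0`, then one of its two perturbations by half the area
form is positive at points arbitrarily close to `w`. -/
theorem exists_sign_frequently_pos {g w : Plane} (hw : w ≠ 0) (hg : 0 ≤ inner ℝ g w) :
    ∃ s : ℝ, (s = 1 ∨ s = -1) ∧ ∃ᶠ b in 𝓝 w, 0 < inner ℝ g b + s * omega w b / 2 := by
  -- The sign `s` and the direction `±u` are matched so that the linear form and the area term
  -- cannot cancel.
  have key : ∃ s : ℝ, (s = 1 ∨ s = -1) ∧ ∃ u, 0 < inner ℝ g u + s * omega w u / 2 := by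
    obtain ⟨u, hu⟩ := exists_omega_pos hw
    rcases le_total 0 (inner ℝ g u) with h | h
    · exact ⟨1, Or.inl rfl, u, by linarith⟩
    · refine ⟨-1, Or.inr rfl, (-1 : ℝ) • u, ?_⟩
      rw [omega_smul_right, inner_smul_right]
      linarith
  obtain ⟨s, hs, u, hu⟩ := key
  refine ⟨s, hs, ?_⟩
  have ht : Tendsto (fun τ : ℝ => w + τ • u) (𝓝[>] 0) (𝓝 w) := by
    have : Continuous fun τ : ℝ => w + τ • u := by fun_prop
    simpa using (this.tendsto 0).mono_left nhdsWithin_le_nhds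
  refine ht.frequently (Eventually.frequently ?_)
  filter_upwards [self_mem_nhdsWithin] with τ (hτ : 0 < τ)
  rw [inner_add_right, inner_smul_right, omega_add_right, omega_smul_right, omega_self]
  nlinarith [mul_pos hτ hu]

namespace Heisenberg

/-! ### Homogeneous distances and the geometry of the shadow -/

theorem dilation_dilation (s t : ℝ) (p : Heisenberg) :
    dilation s (dilation t p) = dilation (s * t) p := by
  ext1
  · simp [dilation, mul_smul]
  · simp only [dilation]; ring

theorem dilation_one (t : ℝ) : dilation t 1 = 1 := by
  ext1 <;> simp [dilation, one_v, one_z]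

theorem IsHomogeneousDistance.dist_eq {d : MetricSpace Heisenberg}
    (hd : IsHomogeneousDistance d) (p q : Heisenberg) : dist p q = dist 1 (p⁻¹ * q) := by
  rw [← hd.left_invariant p⁻¹ p q, inv_mul_cancel]

variable {d : MetricSpace Heisenberg} {φ : Plane → ℝ}

theorem IsHomogeneousDistance.dist_one_dilation (hd : IsHomogeneousDistance d) {t : ℝ}
    (ht : 0 < t) (p : Heisenberg) : dist 1 (dilation t p) = t * dist 1 p := by
  rw [← hd.homogeneous t ht, dilation_one]

theorem IsHomogeneousDistance.inv_mem (hd : IsHomogeneousDistance d) {p : Heisenberg}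
    (hp : p ∈ unitBall d) : p⁻¹ ∈ unitBall d := by
  have h : dist 1 p⁻¹ = dist 1 p := by
    rw [dist_comm, hd.dist_eq, inv_inv, mul_one]
  exact h.trans_le hp

theorem IsHomogeneousDistance.dilation_mem (hd : IsHomogeneousDistance d) {p : Heisenberg}
    (hp : p ∈ unitBall d) {t : ℝ} (ht : 0 < t) (ht1 : t ≤ 1) : dilation t p ∈ unitBall d := by
  change dist _ _ ≤ _
  have hp : dist 1 p ≤ 1 := hp
  rw [hd.dist_one_dilation ht]
  nlinarith [dist_nonneg (x := (1 : Heisenberg)) (y := p)]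

theorem IsHomogeneousDistance.dist_one_mul_le (hd : IsHomogeneousDistance d) (p q : Heisenberg) :
    dist 1 (p * q) ≤ dist 1 p + dist 1 q := by
  have := dist_triangle 1 p (p * q)
  rwa [hd.dist_eq p (p * q), inv_mul_cancel_left] at this

/-- The product of the dilates by `a` and `b` of two points of `B` lies in `B` when `a + b = 1`, and
horizontal components add. -/
theorem IsHomogeneousDistance.convex_shadow (hd : IsHomogeneousDistance d) :
    Convex ℝ (shadow d) := by
  refine convex_iff_forall_pos.2 ?_
  rintro _ ⟨p, hp, rfl⟩ _ ⟨q, hq, rfl⟩ a b ha hb hab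
  refine ⟨dilation a p * dilation b q, ?_, rfl⟩
  have hp : dist 1 p ≤ 1 := hp
  have hq : dist 1 q ≤ 1 := hq
  have h := hd.dist_one_mul_le (dilation a p) (dilation b q)
  rw [hd.dist_one_dilation ha, hd.dist_one_dilation hb] at h
  change dist _ _ ≤ _
  nlinarith

theorem IsHomogeneousDistance.neg_mem_shadow (hd : IsHomogeneousDistance d) {v : Plane}
    (hv : v ∈ shadow d) : -v ∈ shadow d := by
  obtain ⟨p, hp, rfl⟩ := hv
  exact ⟨p⁻¹, hd.inv_mem hp, rfl⟩

theorem zero_mem_shadow : (0 : Plane) ∈ shadow d :=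
  ⟨1, by change dist _ _ ≤ _; simp, rfl⟩

theorem IsHomogeneousDistance.smul_mem_shadow (hd : IsHomogeneousDistance d) {v : Plane}
    (hv : v ∈ shadow d) {t : ℝ} (ht : |t| ≤ 1) : t • v ∈ shadow d := by
  have hpos : ∀ u ∈ shadow d, |t| • u ∈ shadow d := fun u hu => by
    have := hd.convex_shadow zero_mem_shadow hu (sub_nonneg.2 ht) (abs_nonneg t) (by ring)
    simpa using this
  rcases abs_choice t with h | h
  · rw [← h]; exact hpos v hv
  · have := hpos (-v) (hd.neg_mem_shadow hv)
    rw [h] at this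
    simpa using this

theorem IsHomogeneousDistance.exists_smul_mem_shadow (hd : IsHomogeneousDistance d) (v : Plane) :
    ∃ t : ℝ, 0 < t ∧ t • v ∈ shadow d := by
  set r := dist (1 : Heisenberg) ⟨v, 0⟩
  have hr : 0 ≤ r := dist_nonneg
  have ht : 0 < (r + 1)⁻¹ := by positivity
  refine ⟨(r + 1)⁻¹, ht, dilation (r + 1)⁻¹ ⟨v, 0⟩, ?_, rfl⟩
  change dist _ _ ≤ _
  rw [hd.dist_one_dilation ht]
  change (r + 1)⁻¹ * r ≤ 1
  rw [inv_mul_le_iff₀ (by positivity)]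
  linarith

theorem IsHomogeneousDistance.zero_mem_interior_shadow (hd : IsHomogeneousDistance d) :
    (0 : Plane) ∈ interior (shadow d) := by
  obtain ⟨a, ha, hax⟩ := hd.exists_smul_mem_shadow !₂[1, 0]
  obtain ⟨b, hb, hby⟩ := hd.exists_smul_mem_shadow !₂[0, 1]
  refine mem_interior_iff_mem_nhds.2 ?_
  have h0 : ∀ᶠ v : Plane in 𝓝 0, |2 * v 0 / a| < 1 := by
    have : Continuous fun v : Plane => |2 * v 0 / a| := by fun_prop
    exact this.continuousAt.eventually (gt_mem_nhds (by simp))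
  have h1 : ∀ᶠ v : Plane in 𝓝 0, |2 * v 1 / b| < 1 := by
    have : Continuous fun v : Plane => |2 * v 1 / b| := by fun_prop
    exact this.continuousAt.eventually (gt_mem_nhds (by simp))
  filter_upwards [h0, h1] with v hv0 hv1
  have hc := hd.convex_shadow (hd.smul_mem_shadow hax hv0.le) (hd.smul_mem_shadow hby hv1.le)
    (a := 1 / 2) (b := 1 / 2) (by norm_num) (by norm_num) (by norm_num)
  convert hc using 1
  ext i
  fin_cases i
  · simp; field_simp
  · simp; field_simp

theorem IsHomogeneousDistance.smul_mem_interior_shadow (hd : IsHomogeneousDistance d) {w : Plane}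
    (hw : w ∈ shadow d) {t : ℝ} (ht0 : 0 ≤ t) (ht1 : t < 1) : t • w ∈ interior (shadow d) := by
  have := hd.convex_shadow.combo_interior_self_mem_interior hd.zero_mem_interior_shadow hw
    (sub_pos.2 ht1) ht0 (by ring)
  simpa using this

/-! ### From BCP to chains of horizontal vectors -/

/-- If each point of a sequence in `B` is at distance more than one from all sufficiently small
dilates of its successors, then suitable dilates of the points center a Besicovitch family. -/
theorem exists_bound_of_bcp (hd : IsHomogeneousDistance d) (hBCP : BesicovitchCoveringProperty d) :
    ∃ C : ℕ, ∀ (n : ℕ) (q : Fin n → Heisenberg), (∀ i, q i ∈ unitBall d) →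
      (∀ i j, i < j → ∀ᶠ t in 𝓝[>] (0 : ℝ), 1 < dist (dilation t (q j)) (q i)) → n ≤ C := by
  obtain ⟨C, -, hC⟩ := hBCP
  refine ⟨C, fun n q hq hsep => ?_⟩
  -- Dividing the scales `ε ^ j` and `ε ^ i` by the larger one leaves `ε ^ (j - i)`; there are
  -- finitely many pairs, so one `ε` serves them all.
  have hev : ∀ᶠ ε in 𝓝[>] (0 : ℝ), ∀ i j : Fin n, i < j →
      1 < dist (dilation (ε ^ (j.val - i.val)) (q j)) (q i) := by
    refine eventually_all.2 fun i => eventually_all.2 fun j => eventually_imp_distrib_left.2 ?_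
    intro hij
    have hk : j.val - i.val ≠ 0 := by have : i.val < j.val := hij; omega
    have ht : Tendsto (fun ε : ℝ => ε ^ (j.val - i.val)) (𝓝[>] 0) (𝓝[>] 0) := by
      refine tendsto_nhdsWithin_iff.2 ⟨?_, ?_⟩
      · have := (continuous_pow (M := ℝ) (j.val - i.val)).tendsto 0
        rw [zero_pow hk] at this
        exact this.mono_left nhdsWithin_le_nhds
      · filter_upwards [self_mem_nhdsWithin] with ε (hε : 0 < ε)
        exact pow_pos hε _
    exact ht.eventually (hsep i j hij)
  have hlt : ∀ᶠ ε in 𝓝[>] (0 : ℝ), ε < 1 :=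
    nhdsWithin_le_nhds (gt_mem_nhds (by norm_num))
  obtain ⟨ε, hε, hε1, hε0⟩ :=
    (hev.and (hlt.and (self_mem_nhdsWithin : ∀ᶠ ε in 𝓝[>] (0 : ℝ), ε ∈ Set.Ioi 0))).exists
  have hε0 : 0 < ε := hε0
  have hlong : ∀ i j : Fin n, i < j →
      ε ^ i.val < dist (dilation (ε ^ j.val) (q j)) (dilation (ε ^ i.val) (q i)) := by
    intro i j hij
    have hpi : 0 < ε ^ i.val := pow_pos hε0 _
    have hle : i.val ≤ j.val := hij.le
    have he : ε ^ j.val = ε ^ i.val * ε ^ (j.val - i.val) := by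
      rw [← pow_add, Nat.add_sub_cancel' hle]
    rw [he, ← dilation_dilation, hd.homogeneous _ hpi]
    exact lt_mul_of_one_lt_right hpi (hε i j hij)
  set b : Fin n → Heisenberg × ℝ := fun i => (dilation (ε ^ i.val) (q i), ε ^ i.val)
  have hinj : Function.Injective b := by
    intro i j h
    have h2 : ε ^ i.val = ε ^ j.val := congrArg Prod.snd h
    exact Fin.ext ((pow_right_injective₀ hε0 hε1.ne) h2)
  have hF : IsBesicovitchFamily d (Set.range b) := by
    refine ⟨?_, ?_, ⟨1, ?_⟩⟩
    · rintro _ ⟨i, rfl⟩; exact pow_pos hε0 _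
    · rintro _ ⟨i, rfl⟩ _ ⟨j, rfl⟩ hne hmem
      have hmem : dist (dilation (ε ^ i.val) (q i)) (dilation (ε ^ j.val) (q j)) ≤ ε ^ j.val :=
        Metric.mem_closedBall.1 hmem
      rcases lt_trichotomy i j with h | h | h
      · have h1 := hlong i j h
        rw [dist_comm] at h1
        have h2 : ε ^ j.val ≤ ε ^ i.val := pow_le_pow_of_le_one hε0.le hε1.le h.le
        linarith
      · exact hne (by rw [h])
      · have h1 := hlong j i h
        linarith
    · refine Set.mem_iInter₂.2 ?_
      rintro _ ⟨i, rfl⟩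
      have hi : dist 1 (q i) ≤ 1 := hq i
      have hpi : 0 < ε ^ i.val := pow_pos hε0 _
      refine Metric.mem_closedBall.2 ?_
      change dist 1 (dilation (ε ^ i.val) (q i)) ≤ ε ^ i.val
      rw [hd.dist_one_dilation hpi]
      exact mul_le_of_le_one_right hpi.le hi
  have hcard := hC _ hF
  rw [← Set.image_univ, hinj.encard_image, Set.encard_univ] at hcard
  simpa using hcard

theorem IsProfile.sign_mem (hd : IsHomogeneousDistance d) (hφ : IsProfile d φ) {s : ℝ}
    (hs : s = 1 ∨ s = -1) {w : Plane} (hw : w ∈ shadow d) :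
    (⟨s • w, s * φ w⟩ : Heisenberg) ∈ unitBall d := by
  have h1 : (⟨w, φ w⟩ : Heisenberg) ∈ unitBall d := by
    rw [hφ.unitBall_eq]
    have := hφ.nonneg _ hw
    have := hφ.nonneg _ (hd.neg_mem_shadow hw)
    exact ⟨hw, by dsimp only; linarith, le_rfl⟩
  rcases hs with rfl | rfl
  · simpa using h1
  · have := hd.inv_mem h1
    convert this using 1
    ext1 <;> simp [inv_v, inv_z]

/-- The points `±(w, φ(w))` of the unit sphere are at distance more than one from the small
dilates of `±(u, z)` as soon as the first variation of the profile allows it. -/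
theorem IsProfile.eventually_one_lt_dist (hd : IsHomogeneousDistance d) (hφ : IsProfile d φ)
    {s : ℝ} (hs : s = 1 ∨ s = -1) {w u : Plane} (z : ℝ) (hw : DifferentiableAt ℝ φ w)
    (h : 0 < inner ℝ (gradient φ w) u + s * omega w u / 2) :
    ∀ᶠ t in 𝓝[>] (0 : ℝ),
      1 < dist (dilation t ⟨s • u, s * z⟩) (⟨s • w, s * φ w⟩ : Heisenberg) := by
  have hline : HasDerivAt (fun t : ℝ => w - t • u) (-u) 0 := by
    simpa using ((hasDerivAt_id (0 : ℝ)).smul_const u).const_sub w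
  have hw' : HasFDerivAt φ (fderiv ℝ φ w) (w - (0 : ℝ) • u) := by
    simpa using hw.hasFDerivAt
  have h1 := hw'.comp_hasDerivAt (0 : ℝ) hline
  -- For `s = 1` this function is `φ` minus the vertical coordinate of the translated point; for `s
  -- = -1` the same after inversion. A negative value puts the point outside `B`. The height `z`
  -- enters only at second order.
  have h2 : HasDerivAt
      (fun t : ℝ => φ (w - t • u) - φ w + t ^ 2 * z + t * (s * omega u w / 2))
      (fderiv ℝ φ w (-u) + s * omega u w / 2) 0 := by
    have e1 : HasDerivAt (fun t : ℝ => t ^ 2 * z) 0 0 := by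
      simpa using ((hasDerivAt_id (0 : ℝ)).pow 2).mul_const z
    have e2 : HasDerivAt (fun t : ℝ => t * (s * omega u w / 2)) (s * omega u w / 2) 0 := by
      simpa using (hasDerivAt_id (0 : ℝ)).mul_const (s * omega u w / 2)
    exact (((h1.sub_const (φ w)).add e1).add e2).congr_deriv (by simp)
  have hgrad : fderiv ℝ φ w (-u) = - inner ℝ (gradient φ w) u := by
    simp [gradient]
  have h3 := eventually_neg_of_hasDerivAt_neg h2 (by simp)
    (by rw [hgrad, omega_swap u w]; linarith)
  filter_upwards [h3] with t ht
  by_contra hcon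
  rw [not_lt, hd.dist_eq] at hcon
  have hmem : (dilation t ⟨s • u, s * z⟩)⁻¹ * (⟨s • w, s * φ w⟩ : Heisenberg) ∈ unitBall d := hcon
  rw [hφ.unitBall_eq] at hmem
  obtain ⟨-, hlow, hup⟩ := hmem
  rcases hs with rfl | rfl
  · simp only [dilation, mul_v, mul_z, inv_v, inv_z, one_smul, one_mul] at hup
    have ev : -(t • u) + w = w - t • u := by abel
    have eo : omega (-(t • u)) w = - (t * omega u w) := by
      rw [← neg_smul, omega_smul_left]; ring
    rw [ev, eo] at hup
    linarith
  · simp only [dilation, mul_v, mul_z, inv_v, inv_z] at hlow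
    have ev : -(-(t • (-1 : ℝ) • u) + (-1 : ℝ) • w) = w - t • u := by
      simp only [neg_smul, one_smul, smul_neg]; abel
    have eo : omega (-(t • (-1 : ℝ) • u)) ((-1 : ℝ) • w) = - (t * omega u w) := by
      rw [← neg_smul, omega_smul_left, omega_smul_right, omega_smul_left]; ring
    rw [ev, eo] at hlow
    linarith

theorem IsProfile.exists_bound_of_bcp (hd : IsHomogeneousDistance d) (hφ : IsProfile d φ)
    (hBCP : BesicovitchCoveringProperty d) (hdiff : DifferentiableOn ℝ φ (interior (shadow d))) :
    ∃ C : ℕ, ∀ (s : ℝ) (_ : s = 1 ∨ s = -1) (n : ℕ) (w : Fin n → Plane),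
      (∀ i, w i ∈ interior (shadow d)) →
      (∀ i j, i < j → 0 < inner ℝ (gradient φ (w i)) (w j) + s * omega (w i) (w j) / 2) →
      n ≤ C := by
  obtain ⟨C, hC⟩ := Heisenberg.exists_bound_of_bcp hd hBCP
  refine ⟨C, fun s hs n w hw hpos => hC n (fun i => ⟨s • w i, s * φ (w i)⟩) ?_ ?_⟩
  · exact fun i => hφ.sign_mem hd hs (interior_subset (hw i))
  · exact fun i j hij => hφ.eventually_one_lt_dist hd hs _
      (hdiff.differentiableAt (isOpen_interior.mem_nhds (hw i))) (hpos i j hij)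

/-! ### Radial decrease of the profile -/

theorem contDiffAt_gradient {U : Set Plane} (hU : IsOpen U) (hφ : ContDiffOn ℝ 2 φ U) {w : Plane}
    (hw : w ∈ U) : ContDiffAt ℝ 1 (gradient φ) w := by
  have h : ContDiffAt ℝ 1 (fderiv ℝ φ) w :=
    (hφ.contDiffAt (hU.mem_nhds hw)).fderiv_right (by norm_num)
  exact (InnerProductSpace.toDual ℝ Plane).symm.contDiff.contDiffAt.comp w h

/-- The profile of a homogeneous distance satisfying BCP decreases along rays. -/
theorem inner_gradient_neg (hd : IsHomogeneousDistance d) (hφ : IsProfile d φ)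
    (hBCP : BesicovitchCoveringProperty d) (hC2 : ContDiffOn ℝ 2 φ (interior (shadow d)))
    {w : Plane} (hw : w ∈ interior (shadow d)) (hw0 : w ≠ 0) :
    inner ℝ (gradient φ w) w < 0 := by
  by_contra! hcon
  obtain ⟨C, hC⟩ := hφ.exists_bound_of_bcp hd hBCP (hC2.differentiableOn (by norm_num))
  obtain ⟨s, hs, hfr⟩ := exists_sign_frequently_pos hw0 hcon
  have hcont : ∀ b, ContinuousAt (fun a => inner ℝ (gradient φ a) b + s * omega a b / 2) w := by
    intro b
    have h1 := (contDiffAt_gradient isOpen_interior hC2 hw).continuousAt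
    have h2 := (continuous_omega_left b).continuousAt (x := w)
    exact (h1.inner continuousAt_const).add ((h2.const_mul s).div_const 2)
  obtain ⟨q, hqU, -, hq⟩ := exists_seq_pos_of_frequently
    (G := fun a b => inner ℝ (gradient φ a) b + s * omega a b / 2) hcont hfr
    (isOpen_interior.mem_nhds hw) (C + 1)
  have := hC s hs _ q hqU hq
  omega

theorem strictAntiOn_ray (hd : IsHomogeneousDistance d) (hφ : IsProfile d φ)
    (hBCP : BesicovitchCoveringProperty d) (hC2 : ContDiffOn ℝ 2 φ (interior (shadow d)))
    {w : Plane} (hw : w ∈ shadow d) (hw0 : w ≠ 0) :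
    StrictAntiOn (fun t : ℝ => φ (t • w)) (Set.Ico 0 1) := by
  have hder : ∀ t ∈ Set.Ico (0 : ℝ) 1,
      HasDerivAt (fun t : ℝ => φ (t • w)) (inner ℝ (gradient φ (t • w)) w) t := by
    intro t ht
    have hdiff : DifferentiableAt ℝ φ (t • w) := (hC2.differentiableOn (by norm_num)).differentiableAt
      (isOpen_interior.mem_nhds (hd.smul_mem_interior_shadow hw ht.1 ht.2))
    have hl : HasDerivAt (fun t : ℝ => t • w) w t := by
      simpa using (hasDerivAt_id t).smul_const w
    exact (hdiff.hasFDerivAt.comp_hasDerivAt t hl).congr_deriv (by simp [gradient])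
  refine strictAntiOn_of_deriv_neg (convex_Ico 0 1)
    (fun t ht => (hder t ht).continuousAt.continuousWithinAt) ?_
  intro t ht
  rw [interior_Ico] at ht
  rw [(hder t ⟨ht.1.le, ht.2⟩).deriv]
  have h := inner_gradient_neg hd hφ hBCP hC2
    (hd.smul_mem_interior_shadow hw ht.1.le ht.2) (smul_ne_zero ht.1.ne' hw0)
  rw [inner_smul_right] at h
  exact (pos_iff_neg_of_mul_neg h).1 ht.1

theorem IsProfile.sq_mul_le (hd : IsHomogeneousDistance d) (hφ : IsProfile d φ) {w : Plane}
    (hw : w ∈ shadow d) {t : ℝ} (ht0 : 0 < t) (ht1 : t ≤ 1) : t ^ 2 * φ w ≤ φ (t • w) := by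
  have h := hd.dilation_mem (hφ.sign_mem hd (Or.inl rfl) hw) ht0 ht1
  rw [hφ.unitBall_eq] at h
  simpa [dilation] using h.2.2

theorem profile_lt (hd : IsHomogeneousDistance d) (hφ : IsProfile d φ)
    (hBCP : BesicovitchCoveringProperty d) (hC2 : ContDiffOn ℝ 2 φ (interior (shadow d)))
    {w : Plane} (hw : w ∈ shadow d) (hw0 : w ≠ 0) : φ w < φ 0 := by
  have hanti := strictAntiOn_ray hd hφ hBCP hC2 hw hw0
  have hhalf : φ ((1 / 2 : ℝ) • w) < φ 0 := by
    have := hanti (a := 0) (b := 1 / 2) (by norm_num) (by norm_num) (by norm_num)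
    simpa using this
  refine lt_of_le_of_lt ?_ hhalf
  -- When `w` is on the boundary of `K`, continuity of `φ` there is not available; the bound `t²
  -- φ(w) ≤ φ(t w)`, from dilating `(w, φ w)`, replaces it as `t → 1`.
  have hlim : Tendsto (fun t : ℝ => t ^ 2 * φ w) (𝓝[<] 1) (𝓝 (φ w)) := by
    have : Continuous fun t : ℝ => t ^ 2 * φ w := by fun_prop
    simpa using (this.tendsto 1).mono_left nhdsWithin_le_nhds
  refine le_of_tendsto hlim ?_
  filter_upwards [Ioo_mem_nhdsLT (show (1 / 2 : ℝ) < 1 by norm_num)] with t ht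
  have ht0 : 0 < t := by linarith [ht.1]
  refine (hφ.sq_mul_le hd hw ht0 ht.2.le).trans ?_
  exact (hanti (by norm_num) ⟨ht0.le, ht.2⟩ ht.1).le

/-! ### Second order behaviour at the origin -/

theorem eventually_smul_mem {U : Set Plane} (hU : U ∈ 𝓝 (0 : Plane)) (v : Plane) :
    ∀ᶠ t in 𝓝[>] (0 : ℝ), t • v ∈ U := by
  have h : Continuous fun t : ℝ => t • v := by fun_prop
  have h' := h.tendsto 0
  rw [zero_smul] at h'
  exact (h'.mono_left nhdsWithin_le_nhds).eventually hU

theorem gradient_zero (hd : IsHomogeneousDistance d) (hφ : IsProfile d φ)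
    (hBCP : BesicovitchCoveringProperty d) (hC2 : ContDiffOn ℝ 2 φ (interior (shadow d))) :
    gradient φ 0 = 0 := by
  have h0 := hd.zero_mem_interior_shadow
  have hmax : IsLocalMax φ 0 := by
    filter_upwards [isOpen_interior.mem_nhds h0] with w hw
    rcases eq_or_ne w 0 with rfl | hne
    · exact le_rfl
    · exact (profile_lt hd hφ hBCP hC2 (interior_subset hw) hne).le
  simp [gradient, hmax.fderiv_eq_zero]

theorem tendsto_inner_gradient_smul (hd : IsHomogeneousDistance d) (hφ : IsProfile d φ)
    (hBCP : BesicovitchCoveringProperty d) (hC2 : ContDiffOn ℝ 2 φ (interior (shadow d)))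
    (a b : Plane) :
    Tendsto (fun t : ℝ => t⁻¹ * inner ℝ (gradient φ (t • a)) b) (𝓝[>] 0)
      (𝓝 (inner ℝ (hessian φ 0 a) b)) := by
  have hg : HasFDerivAt (gradient φ) (hessian φ 0) ((0 : ℝ) • a) := by
    rw [zero_smul]
    exact ((contDiffAt_gradient isOpen_interior hC2
      hd.zero_mem_interior_shadow).differentiableAt (by norm_num)).hasFDerivAt
  have hl : HasDerivAt (fun t : ℝ => t • a) a 0 := by
    simpa using (hasDerivAt_id (0 : ℝ)).smul_const a
  have h1 := (hg.comp_hasDerivAt (0 : ℝ) hl).inner ℝ (hasDerivAt_const (0 : ℝ) b)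
  have h2 := (hasDerivAt_iff_tendsto_slope.1 h1).mono_left
    (nhdsWithin_mono (0 : ℝ) (s := Set.Ioi 0) fun t (ht : 0 < t) => ht.ne')
  simp only [inner_zero_right, zero_add] at h2
  refine h2.congr fun t => ?_
  simp only [slope_def_field, Function.comp_apply, zero_smul, gradient_zero hd hφ hBCP hC2,
    inner_zero_left, sub_zero, div_eq_inv_mul]

theorem inner_hessian_nonpos (hd : IsHomogeneousDistance d) (hφ : IsProfile d φ)
    (hBCP : BesicovitchCoveringProperty d) (hC2 : ContDiffOn ℝ 2 φ (interior (shadow d)))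
    (v : Plane) : inner ℝ (hessian φ 0 v) v ≤ 0 := by
  rcases eq_or_ne v 0 with rfl | hv
  · simp
  refine le_of_tendsto (tendsto_inner_gradient_smul hd hφ hBCP hC2 v v) ?_
  filter_upwards [eventually_smul_mem (isOpen_interior.mem_nhds hd.zero_mem_interior_shadow) v,
    self_mem_nhdsWithin] with t htv (ht : 0 < t)
  have h := inner_gradient_neg hd hφ hBCP hC2 htv (smul_ne_zero ht.ne' hv)
  rw [inner_smul_right] at h
  exact mul_nonpos_of_nonneg_of_nonpos (inv_nonneg.2 ht.le) ((pos_iff_neg_of_mul_neg h).1 ht).le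

/-- The Hessian at the origin is negative definite; `C²` regularity of the profile is enough. -/
theorem inner_hessian_neg (hd : IsHomogeneousDistance d) (hφ : IsProfile d φ)
    (hBCP : BesicovitchCoveringProperty d) (hC2 : ContDiffOn ℝ 2 φ (interior (shadow d)))
    {v : Plane} (hv : v ≠ 0) : inner ℝ (hessian φ 0 v) v < 0 := by
  by_contra! hcon
  obtain ⟨C, hC⟩ := hφ.exists_bound_of_bcp hd hBCP (hC2.differentiableOn (by norm_num))
  obtain ⟨s, hs, hfr⟩ := exists_sign_frequently_pos hv hcon
  have hcont : ∀ b, ContinuousAt (fun a => inner ℝ (hessian φ 0 a) b + s * omega a b / 2) v := by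
    intro b
    have h1 := (hessian φ 0).continuous.continuousAt (x := v)
    have h2 := (continuous_omega_left b).continuousAt (x := v)
    exact (h1.inner continuousAt_const).add ((h2.const_mul s).div_const 2)
  obtain ⟨q, -, -, hq⟩ := exists_seq_pos_of_frequently
    (G := fun a b => inner ℝ (hessian φ 0 a) b + s * omega a b / 2) hcont hfr
    univ_mem (C + 1)
  -- The chain was built for the limiting form; it is finite, so one small `t` carries it into `K`
  -- with all inequalities kept.
  have hmem : ∀ᶠ t in 𝓝[>] (0 : ℝ), ∀ i, t • q i ∈ interior (shadow d) :=
    eventually_all.2 fun i =>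
      eventually_smul_mem (isOpen_interior.mem_nhds hd.zero_mem_interior_shadow) (q i)
  have hpos : ∀ᶠ t in 𝓝[>] (0 : ℝ), ∀ i j, i < j →
      0 < t⁻¹ * inner ℝ (gradient φ (t • q i)) (q j) + s * omega (q i) (q j) / 2 := by
    refine eventually_all.2 fun i => eventually_all.2 fun j => eventually_imp_distrib_left.2 ?_
    intro hij
    exact ((tendsto_inner_gradient_smul hd hφ hBCP hC2 (q i) (q j)).add_const _).eventually
      (lt_mem_nhds (hq i j hij))
  obtain ⟨t, htm, htp, ht⟩ :=
    (hmem.and (hpos.and (self_mem_nhdsWithin : ∀ᶠ t in 𝓝[>] (0 : ℝ), t ∈ Set.Ioi 0))).exists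
  have ht : 0 < t := ht
  have := hC s hs _ (fun i => t • q i) htm fun i j hij => by
    have h := mul_pos (pow_pos ht 2) (htp i j hij)
    rw [omega_smul_left, omega_smul_right, inner_smul_right]
    have he : t * inner ℝ (gradient φ (t • q i)) (q j) + s * (t * (t * omega (q i) (q j))) / 2 =
        t ^ 2 * (t⁻¹ * inner ℝ (gradient φ (t • q i)) (q j) + s * omega (q i) (q j) / 2) := by
      field_simp
    rwa [he]
  omega

end Heisenberg

theorem theorem1p6 (d : MetricSpace Heisenberg) (hd : Heisenberg.IsHomogeneousDistance d)
    (φ : Plane → ℝ) (hφ : Heisenberg.IsProfile d φ)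
    (hBCP : BesicovitchCoveringProperty d)
    (hC2 : ContDiffOn ℝ 2 φ (interior (Heisenberg.shadow d))) :
    (∀ w ∈ interior (Heisenberg.shadow d), w ≠ 0 → inner ℝ (gradient φ w) w < 0) ∧
    (∀ w ∈ Heisenberg.shadow d, w ≠ 0 → φ w < φ 0) ∧
    (∀ v : Plane, inner ℝ (hessian φ 0 v) v ≤ 0) ∧
    (DifferentiableAt ℝ (hessian φ) 0 →
      ∀ v : Plane, v ≠ 0 → inner ℝ (hessian φ 0 v) v < 0) :=
  ⟨fun _ hw hw0 => Heisenberg.inner_gradient_neg hd hφ hBCP hC2 hw hw0,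
    fun _ hw hw0 => Heisenberg.profile_lt hd hφ hBCP hC2 hw hw0,
    Heisenberg.inner_hessian_nonpos hd hφ hBCP hC2,
    fun _ _ hv => Heisenberg.inner_hessian_neg hd hφ hBCP hC2 hv⟩
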